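/- Let $\Sigma$ be a finite non-empty alphabet and let $\mathcal{U}=(Q,\Sigma,\delta,Q_0,F)$ be a nondeterministic Büchi automaton with finite state set $Q$, transition function $\delta:Q\times\Sigma\to 2^Q$, initial states $Q_0\neq\varnothing$ and final states $F\neq\varnothing$. An accepting run for $w=a_1a_2\ldots\in\Sigma^\omega$ is a sequence $q_0q_1q_2\ldots\in Q^\omega$ with $q_0\in Q_0$, $q_{i+1}\in\delta(q_i,a_{i+1})$ for all $i\ge 0$, and $q_i\in F$ for infinitely many $i$; let $\mathcal{L}_\omega(\mathcal{U})$ be the set of words in $\Sigma^\omega$ that have at least one accepting run. Suppose that $\mathcal{U}$ is unambiguous (each $w\in\Sigma^\omega$ has at most one accepting run) and strongly connected (every state is reachable from every state in the directed graph with an edge from $q$ to $p$ whenever $p\in\delta(q,a)$ for some $a\in\Sigma$). Let $\mathrm{Pr}$ denote the uniform probability measure on $\Sigma^\omega$, under which the letters are independent and uniformly distributed on $\Sigma$, and consider the linear equation system $$(*)\qquad \zeta_q \;=\; \frac{1}{|\Sigma|}\sum_{a\in\Sigma}\ \sum_{p\in\delta(q,a)}\zeta_p\qquad\text{for all } q\in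 Q$$ in real unknowns $(\zeta_q)_{q\in Q}$. Then the following statements are equivalent: 1. $\mathrm{Pr}(\mathcal{L}_\omega(\mathcal{U}))>0$; 2. $(*)$ has a strictly positive solution, i.e. a solution $(\zeta^*_q)_{q\in Q}$ with $\zeta^*_q>0$ for all $q\in Q$; 3. $(*)$ has a non-zero solution. -/

import Mathlib

open MeasureTheory Filter

/-- A nondeterministic Büchi automaton with state set `Q` and alphabet `A`; finiteness of `Q` and
`A` is assumed where it is used. Infinite words are functions `w : ℕ → A`, whose letters are
`w 0, w 1, …`. -/
structure NBA (Q A : Type*) where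
  /-- The transition function `δ : Q × A → 2^Q`. -/
  δ : Q → A → Finset Q
  /-- The set of initial states. -/
  init : Set Q
  /-- The set of accepting (final) states. -/
  final : Set Q

namespace NBA

variable {Q A : Type*}

/-- `ρ 0, ρ 1, …` is a run for the infinite word `w`, starting in an initial state. -/
def IsRun (U : NBA Q A) (w : ℕ → A) (ρ : ℕ → Q) : Prop :=
  ρ 0 ∈ U.init ∧ ∀ i, ρ (i + 1) ∈ U.δ (ρ i) (w i)

/-- An accepting run visits the set of final states infinitely often. -/
def IsAcceptingRun (U : NBA Q A) (w : ℕ → A) (ρ : ℕ → Q) : Prop :=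
  U.IsRun w ρ ∧ ∃ᶠ i in atTop, ρ i ∈ U.final

/-- The language of infinite words having at least one accepting run. -/
def omegaLanguage (U : NBA Q A) : Set (ℕ → A) :=
  {w | ∃ ρ, U.IsAcceptingRun w ρ}

/-- Each infinite word has at most one accepting run. -/
def Unambiguous (U : NBA Q A) : Prop :=
  ∀ w ρ ρ', U.IsAcceptingRun w ρ → U.IsAcceptingRun w ρ' → ρ = ρ'

/-- The edge relation of the directed graph underlying the automaton. -/
def Edge (U : NBA Q A) (p q : Q) : Prop :=
  ∃ a, q ∈ U.δ p a

/-- Every state is reachable from every state (by a path of length `≥ 0`). -/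
def StronglyConnected (U : NBA Q A) : Prop :=
  ∀ p q, Relation.ReflTransGen U.Edge p q

/-- `ζ` solves the linear system
`ζ q = (1 / |A|) * ∑ a, ∑ p ∈ δ(q, a), ζ p` for all states `q`. -/
def IsSolution [Fintype A] (U : NBA Q A) (ζ : Q → ℝ) : Prop :=
  ∀ q, ζ q = (1 / (Fintype.card A : ℝ)) * ∑ a, ∑ p ∈ U.δ q a, ζ p

end NBA

/-- The uniform probability measure on infinite words: the letters are independent and uniformly
distributed on the alphabet. -/
noncomputable def uniformWordMeasure (A : Type*) [Fintype A] [Nonempty A] [MeasurableSpace A] :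
    Measure (ℕ → A) :=
  Measure.infinitePi fun _ : ℕ => (PMF.uniformOfFintype A).toMeasure

/-! Unambiguity makes the languages accepted from distinct `a`-successors of a state disjoint, so
the probabilities of acceptance from each state solve the system
(`isSolution_measureReal_omegaLanguage`). If one is positive, strong connectivity makes all
positive: 1 → 2.

For 3 → 2, let `U.op` be the right-hand side of the system. A solution `ζ` satisfies `|ζ| ≤ U.op
|ζ|`, so the iterates at `|ζ|` increase. They are bounded: by unambiguity, a finite word leads from
`q` to a given state along at most one run (`weight_eq_sum_reach`). The limit is a fixed point above
`|ζ|`, hence strictly positive.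

For 2 → 1, averaging a positive solution `h` over words of length `n` bounds `h q` by `∑ h` times
the probability that some run from `q` survives `n` steps. So infinite runs exist with positive
probability. Runs that eventually avoid the final states carry no probability
(`measure_run_avoiding_final`), so acceptance from `q` has positive probability. -/

/-- The infinite word with first letter `a` followed by `w`. -/
def consWord {A : Type*} (a : A) (w : ℕ → A) : ℕ → A
  | 0 => a
  | n + 1 => w n

/-- The infinite word `w` without its first letter. -/
def tailWord {A : Type*} (w : ℕ → A) : ℕ → A := fun n => w (n + 1)

/-! ### Self-similarity of the uniform measure under prepending a letter. -/

section Words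

variable {A : Type*}

@[simp] theorem consWord_zero (a : A) (w : ℕ → A) : consWord a w 0 = a := rfl

@[simp] theorem consWord_succ (a : A) (w : ℕ → A) (n : ℕ) : consWord a w (n + 1) = w n := rfl

@[simp] theorem tailWord_consWord (a : A) (w : ℕ → A) : tailWord (consWord a w) = w := rfl

@[simp] theorem consWord_tailWord (w : ℕ → A) : consWord (w 0) (tailWord w) = w := by
  funext n; cases n <;> rfl

theorem consWord_injective (a : A) : Function.Injective (consWord a) :=
  Function.LeftInverse.injective (g := tailWord) (tailWord_consWord a)

variable [MeasurableSpace A]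

theorem measurable_consWord (a : A) : Measurable (consWord a) := by
  refine measurable_pi_lambda _ fun n => ?_
  cases n with
  | zero => exact measurable_const
  | succ n => exact measurable_pi_apply n

theorem measurableEmbedding_consWord [Countable A] [DiscreteMeasurableSpace A] (a : A) :
    MeasurableEmbedding (consWord a) :=
  (measurable_consWord a).measurableEmbedding (consWord_injective a)

theorem measurableSet_of_preimage_consWord [Countable A] [DiscreteMeasurableSpace A]
    {S : Set (ℕ → A)} (h : ∀ a, MeasurableSet (consWord a ⁻¹' S)) : MeasurableSet S := by
  have hS : S = ⋃ a, consWord a '' (consWord a ⁻¹' S) := by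
    ext w
    simp only [Set.mem_iUnion, Set.mem_image, Set.mem_preimage]
    constructor
    · intro hw
      exact ⟨w 0, tailWord w, by simpa using hw, by simp⟩
    · rintro ⟨a, v, hv, rfl⟩
      exact hv
  rw [hS]
  exact .iUnion fun a => (measurableEmbedding_consWord a).measurableSet_image.2 (h a)

theorem measurable_of_comp_consWord [Countable A] [DiscreteMeasurableSpace A] {β : Type*}
    [MeasurableSpace β] {f : (ℕ → A) → β} (h : ∀ a, Measurable fun w => f (consWord a w)) :
    Measurable f :=
  fun _ hS => measurableSet_of_preimage_consWord fun a => h a hS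

variable [Fintype A] [Nonempty A] [DiscreteMeasurableSpace A]

instance : IsProbabilityMeasure (uniformWordMeasure A) := by
  unfold uniformWordMeasure; infer_instance

open Classical in
theorem uniformOfFintype_toMeasure_eq_sum_indicator (s : Set A) :
    (PMF.uniformOfFintype A).toMeasure s =
      (Fintype.card A : ENNReal)⁻¹ * ∑ a, s.indicator (fun _ => (1 : ENNReal)) a := by
  rw [PMF.toMeasure_apply_fintype, Finset.mul_sum]
  refine Finset.sum_congr rfl fun a _ => ?_
  by_cases h : a ∈ s <;> simp [h]

theorem uniformWordMeasure_eq_sum_map :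
    uniformWordMeasure A =
      (Fintype.card A : ENNReal)⁻¹ • ∑ a : A, (uniformWordMeasure A).map (consWord a) := by
  classical
  symm
  refine Measure.eq_infinitePi _ fun s t ht => ?_
  obtain ⟨N, hN⟩ := s.exists_nat_subset_range
  -- Padding the cylinder to an initial segment of indices lets the factor at index 0 be split off.
  set t' : ℕ → Set A := fun i => if i ∈ s then t i else Set.univ with ht'
  have hm : ∀ i, MeasurableSet (t' i) := fun i => .of_discrete
  have hpi : (s : Set ℕ).pi t = ((Finset.range (N + 1) : Finset ℕ) : Set ℕ).pi t' := by
    ext w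
    simp only [Set.mem_pi, Finset.mem_coe, Finset.mem_range, ht']
    constructor
    · intro h i _
      split_ifs with his
      · exact h i his
      · trivial
    · intro h i his
      have := h i (Nat.lt_succ_of_lt (Finset.mem_range.1 (hN his)))
      rwa [if_pos his] at this
  have hprod : ∏ i ∈ s, (PMF.uniformOfFintype A).toMeasure (t i) =
      ∏ i ∈ Finset.range (N + 1), (PMF.uniformOfFintype A).toMeasure (t' i) := by
    rw [← Finset.prod_subset (hN.trans (Finset.range_subset_range.2 N.le_succ))]
    · refine Finset.prod_congr rfl fun i hi => ?_
      simp [ht', hi]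
    · intro i _ hi
      simp [ht', hi]
  have hpre : ∀ a, (uniformWordMeasure A).map (consWord a) ((s : Set ℕ).pi t) =
      (t' 0).indicator (fun _ => (1 : ENNReal)) a *
        ∏ i ∈ Finset.range N, (PMF.uniformOfFintype A).toMeasure (t' (i + 1)) := by
    intro a
    rw [hpi, (measurableEmbedding_consWord a).map_apply]
    by_cases ha : a ∈ t' 0
    · have : consWord a ⁻¹' ((Finset.range (N + 1) : Finset ℕ) : Set ℕ).pi t' =
          ((Finset.range N : Finset ℕ) : Set ℕ).pi fun i => t' (i + 1) := by
        ext w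
        simp only [Set.mem_preimage, Set.mem_pi, Finset.mem_coe, Finset.mem_range]
        constructor
        · intro h i hi
          exact h (i + 1) (Nat.succ_lt_succ hi)
        · intro h i hi
          cases i with
          | zero => exact ha
          | succ i => exact h i (Nat.lt_of_succ_lt_succ hi)
      rw [this, uniformWordMeasure, Measure.infinitePi_pi _ fun i _ => hm (i + 1)]
      simp [ha]
    · have : consWord a ⁻¹' ((Finset.range (N + 1) : Finset ℕ) : Set ℕ).pi t' = ∅ := by
        ext w
        simp only [Set.mem_preimage, Set.mem_pi, Finset.mem_coe, Finset.mem_range,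
          Set.mem_empty_iff_false, iff_false]
        exact fun h => ha (h 0 N.succ_pos)
      rw [this, measure_empty, Set.indicator_of_notMem ha, zero_mul]
  rw [hprod, Finset.prod_range_succ', uniformOfFintype_toMeasure_eq_sum_indicator (t' 0),
    Measure.smul_apply, Measure.finsetSum_apply, Finset.sum_congr rfl fun a _ => hpre a,
    ← Finset.sum_mul, smul_eq_mul]
  ring

theorem uniformWordMeasure_apply (S : Set (ℕ → A)) :
    uniformWordMeasure A S =
      (Fintype.card A : ENNReal)⁻¹ * ∑ a, uniformWordMeasure A (consWord a ⁻¹' S) := by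
  conv_lhs => rw [uniformWordMeasure_eq_sum_map]
  rw [Measure.smul_apply, Measure.finsetSum_apply, smul_eq_mul]
  simp_rw [(measurableEmbedding_consWord _).map_apply]

theorem lintegral_uniformWordMeasure (f : (ℕ → A) → ENNReal) :
    ∫⁻ w, f w ∂uniformWordMeasure A =
      (Fintype.card A : ENNReal)⁻¹ * ∑ a, ∫⁻ w, f (consWord a w) ∂uniformWordMeasure A := by
  conv_lhs => rw [uniformWordMeasure_eq_sum_map]
  rw [lintegral_smul_measure, lintegral_finsetSum_measure, smul_eq_mul]
  simp_rw [(measurableEmbedding_consWord _).lintegral_map]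

theorem uniformWordMeasure_preimage_tailWord (S : Set (ℕ → A)) :
    uniformWordMeasure A (tailWord ⁻¹' S) = uniformWordMeasure A S := by
  rw [uniformWordMeasure_apply]
  simp only [← Set.preimage_comp, Function.comp_def, tailWord_consWord, Set.preimage_id',
    Finset.sum_const, Finset.card_univ, nsmul_eq_mul]
  rw [← mul_assoc, ENNReal.inv_mul_cancel (by simp) (by simp), one_mul]

end Words

/-! ### Accepting runs and languages from single states. -/

namespace NBA

variable {Q A : Type*} (U : NBA Q A)

/-- The automaton `U` with the single initial state `q`. -/
def startingAt (q : Q) : NBA Q A := { U with init := {q} }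

variable {U}

theorem isAcceptingRun_startingAt_iff {q : Q} {w : ℕ → A} {ρ : ℕ → Q} :
    (U.startingAt q).IsAcceptingRun w ρ ↔
      ρ 0 = q ∧ (∀ i, ρ (i + 1) ∈ U.δ (ρ i) (w i)) ∧ ∃ᶠ i in atTop, ρ i ∈ U.final := by
  simp only [IsAcceptingRun, IsRun, and_assoc]
  rfl

theorem frequently_atTop_succ_iff {P : ℕ → Prop} :
    (∃ᶠ i in atTop, P (i + 1)) ↔ ∃ᶠ i in atTop, P i := by
  conv_rhs => rw [← map_add_atTop_eq_nat 1]
  exact frequently_map.symm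

theorem isAcceptingRun_consWord {q p : Q} {a : A} {w : ℕ → A} {ρ : ℕ → Q} (hp : p ∈ U.δ q a)
    (h : (U.startingAt p).IsAcceptingRun w ρ) :
    (U.startingAt q).IsAcceptingRun (consWord a w) (consWord q ρ) := by
  rw [isAcceptingRun_startingAt_iff] at h ⊢
  obtain ⟨h0, hs, hf⟩ := h
  refine ⟨rfl, fun i => ?_, frequently_atTop_succ_iff.1 hf⟩
  cases i with
  | zero => simpa [h0] using hp
  | succ i => exact hs i

theorem IsAcceptingRun.tailWord {q : Q} {w : ℕ → A} {ρ : ℕ → Q}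
    (h : (U.startingAt q).IsAcceptingRun w ρ) :
    ρ 1 ∈ U.δ q (w 0) ∧ (U.startingAt (ρ 1)).IsAcceptingRun (tailWord w) (tailWord ρ) := by
  simp only [isAcceptingRun_startingAt_iff] at h ⊢
  obtain ⟨rfl, hs, hf⟩ := h
  exact ⟨hs 0, rfl, fun i => hs (i + 1), frequently_atTop_succ_iff.2 hf⟩

theorem consWord_mem_omegaLanguage_iff {q : Q} {a : A} {w : ℕ → A} :
    consWord a w ∈ (U.startingAt q).omegaLanguage ↔
      ∃ p ∈ U.δ q a, w ∈ (U.startingAt p).omegaLanguage := by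
  constructor
  · rintro ⟨ρ, hρ⟩
    exact ⟨ρ 1, hρ.tailWord.1, _, hρ.tailWord.2⟩
  · rintro ⟨p, hp, ρ, hρ⟩
    exact ⟨_, isAcceptingRun_consWord hp hρ⟩

/-- Two accepting runs from `q` stay distinct when prefixed by one fixed path from an initial state
to `q`. -/
theorem unambiguous_startingAt (hU : U.Unambiguous) (hsc : U.StronglyConnected)
    (hinit : U.init.Nonempty) (q : Q) : (U.startingAt q).Unambiguous := by
  obtain ⟨q₀, hq₀⟩ := hinit
  have hbase : (U.startingAt q₀).Unambiguous := by
    intro w ρ ρ' h h'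
    refine hU w ρ ρ' ⟨⟨?_, h.1.2⟩, h.2⟩ ⟨⟨?_, h'.1.2⟩, h'.2⟩
    · rwa [(isAcceptingRun_startingAt_iff.1 h).1]
    · rwa [(isAcceptingRun_startingAt_iff.1 h').1]
  induction hsc q₀ q with
  | refl => exact hbase
  | tail _ hedge ih =>
    obtain ⟨a, ha⟩ := hedge
    intro w ρ ρ' h h'
    exact consWord_injective _
      (ih _ _ _ (isAcceptingRun_consWord ha h) (isAcceptingRun_consWord ha h'))

theorem disjoint_omegaLanguage (hU : ∀ q, (U.startingAt q).Unambiguous) {q p p' : Q} {a : A}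
    (hp : p ∈ U.δ q a) (hp' : p' ∈ U.δ q a) (hne : p ≠ p') :
    Disjoint (U.startingAt p).omegaLanguage (U.startingAt p').omegaLanguage := by
  rw [Set.disjoint_left]
  rintro w ⟨ρ, hρ⟩ ⟨ρ', hρ'⟩
  have h := consWord_injective _
    (hU q _ _ _ (isAcceptingRun_consWord hp hρ) (isAcceptingRun_consWord hp' hρ'))
  refine hne ?_
  rw [← (isAcceptingRun_startingAt_iff.1 hρ).1, ← (isAcceptingRun_startingAt_iff.1 hρ').1, h]

/-- Unambiguity makes the projection (word, run) ↦ word injective on the Borel set of accepting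
pairs, so Lusin–Souslin applies. -/
theorem measurableSet_omegaLanguage [Finite Q] [Countable A] [MeasurableSpace A]
    [DiscreteMeasurableSpace A] (hU : U.Unambiguous) : MeasurableSet U.omegaLanguage := by
  let _ : MeasurableSpace Q := ⊤
  have : DiscreteMeasurableSpace Q := ⟨fun _ => trivial⟩
  have hwi : ∀ i, Measurable fun x : (ℕ → A) × (ℕ → Q) => x.1 i := fun i => by fun_prop
  have hρi : ∀ i, Measurable fun x : (ℕ → A) × (ℕ → Q) => x.2 i := fun i => by fun_prop
  have hmeas : MeasurableSet {x : (ℕ → A) × (ℕ → Q) | U.IsAcceptingRun x.1 x.2} := by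
    simp only [IsAcceptingRun, IsRun, frequently_atTop, Set.ofPred_and, Set.ofPred_forall,
      Set.ofPred_exists]
    refine ((hρi 0 (.of_discrete (s := U.init))).inter (.iInter fun i => ?_)).inter
      (.iInter fun n => .iUnion fun m => (MeasurableSet.const _).inter
        (hρi m (.of_discrete (s := U.final))))
    exact ((hρi (i + 1)).prodMk ((hρi i).prodMk (hwi i)))
      (.of_discrete (s := {y : Q × Q × A | y.1 ∈ U.δ y.2.1 y.2.2}))
  have himage : U.omegaLanguage =
      Prod.fst '' {x : (ℕ → A) × (ℕ → Q) | U.IsAcceptingRun x.1 x.2} := by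
    ext w
    simp [omegaLanguage]
  rw [himage]
  refine hmeas.image_of_measurable_injOn measurable_fst ?_
  rintro ⟨w, ρ⟩ h ⟨w', ρ'⟩ h' (rfl : w = w')
  exact Prod.ext rfl (hU _ _ _ h h')

theorem nonempty_omegaLanguage_startingAt (hsc : U.StronglyConnected) (hfinal : U.final.Nonempty)
    (hsucc : ∀ q, ∃ p, U.Edge q p) (q : Q) : (U.startingAt q).omegaLanguage.Nonempty := by
  obtain ⟨f, hf⟩ := hfinal
  -- `S n` holds the states with a path of length `n` to a final state. The run built below always
  -- decreases the distance `d` until it hits a final state.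
  let S : ℕ → Set Q := fun n => Nat.rec U.final (fun _ T => {q | ∃ p ∈ T, U.Edge q p}) n
  have hS : ∀ q, ∃ n, q ∈ S n := fun q => by
    induction hsc q f using Relation.ReflTransGen.head_induction_on with
    | refl => exact ⟨0, hf⟩
    | head hedge _ ih =>
      obtain ⟨n, hn⟩ := ih
      exact ⟨n + 1, _, hn, hedge⟩
  let d : Q → ℕ := fun q => sInf {n | q ∈ S n}
  have hstep : ∀ q, ∃ p a, p ∈ U.δ q a ∧ (q ∈ U.final ∨ d p < d q) := by
    intro q
    rcases hd : d q with _ | n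
    · obtain ⟨p, a, ha⟩ := hsucc q
      have : q ∈ S (d q) := Nat.sInf_mem (hS q)
      rw [hd] at this
      exact ⟨p, a, ha, .inl this⟩
    · have : q ∈ S (d q) := Nat.sInf_mem (hS q)
      rw [hd] at this
      obtain ⟨p, hp, a, ha⟩ := this
      exact ⟨p, a, ha, .inr (Nat.lt_succ_of_le (Nat.sInf_le hp))⟩
  choose next letter hδ hd using hstep
  have hvisit : ∀ n q, d q = n → ∃ k, next^[k] q ∈ U.final := by
    intro n
    induction n using Nat.strong_induction_on with
    | _ n ih =>
      intro q hq
      rcases hd q with h | h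
      · exact ⟨0, h⟩
      · obtain ⟨k, hk⟩ := ih _ (hq ▸ h) (next q) rfl
        exact ⟨k + 1, hk⟩
  refine ⟨fun i => letter (next^[i] q), fun i => next^[i] q,
    isAcceptingRun_startingAt_iff.2 ⟨rfl, fun i => ?_, frequently_atTop.2 fun n => ?_⟩⟩
  · rw [Function.iterate_succ_apply']
    exact hδ _
  · obtain ⟨k, hk⟩ := hvisit _ (next^[n] q) rfl
    exact ⟨k + n, Nat.le_add_left _ _, by rwa [Function.iterate_add_apply]⟩

/-! ### The averaging operator of the linear system. -/

section Operator

variable [Fintype A]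

variable (U) in
/-- The operator on real vectors whose fixed points are the solutions of the linear system. -/
noncomputable def op (ζ : Q → ℝ) : Q → ℝ :=
  fun q => (1 / (Fintype.card A : ℝ)) * ∑ a, ∑ p ∈ U.δ q a, ζ p

theorem isSolution_iff_op_eq {ζ : Q → ℝ} : U.IsSolution ζ ↔ U.op ζ = ζ :=
  ⟨fun h => funext fun q => (h q).symm, fun h q => (congrFun h q).symm⟩

theorem op_mono : Monotone U.op := by
  intro x y h q
  simp only [op]
  gcongr with a _ p _
  exact h p

theorem op_nonneg {x : Q → ℝ} (hx : 0 ≤ x) : 0 ≤ U.op x := fun q =>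
  mul_nonneg (by positivity) (Finset.sum_nonneg fun _ _ => Finset.sum_nonneg fun p _ => hx p)

theorem iterate_op_nonneg {x : Q → ℝ} (hx : 0 ≤ x) (n : ℕ) : 0 ≤ U.op^[n] x := by
  induction n with
  | zero => exact hx
  | succ n ih => rw [Function.iterate_succ_apply']; exact op_nonneg ih

theorem continuous_op : Continuous U.op := by
  unfold op
  fun_prop

theorem op_sub (x y : Q → ℝ) : U.op (x - y) = U.op x - U.op y := by
  funext q
  simp [op, Finset.sum_sub_distrib, mul_sub]

theorem op_smul (c : ℝ) (x : Q → ℝ) : U.op (c • x) = c • U.op x := by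
  funext q
  simp [op, ← Finset.mul_sum, mul_left_comm]

theorem abs_op_le (x : Q → ℝ) : |U.op x| ≤ U.op |x| := by
  intro q
  simp only [op, Pi.abs_apply, abs_mul]
  rw [abs_of_nonneg (by positivity : (0 : ℝ) ≤ 1 / (Fintype.card A : ℝ))]
  gcongr
  exact (Finset.abs_sum_le_sum_abs _ _).trans
    (Finset.sum_le_sum fun a _ => Finset.abs_sum_le_sum_abs _ _)

theorem op_eq_of_tendsto_iterate {x y : Q → ℝ}
    (h : Tendsto (fun n => U.op^[n] x) atTop (nhds y)) : U.op y = y :=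
  isFixedPt_of_tendsto_iterate h continuous_op.continuousAt

/-- Positivity of a nonnegative supersolution propagates backwards along edges. -/
theorem pos_of_reflTransGen [Nonempty A] {x : Q → ℝ} (hx : 0 ≤ x) (hop : U.op x ≤ x) {p q : Q}
    (hpq : Relation.ReflTransGen U.Edge p q) (hq : 0 < x q) : 0 < x p := by
  induction hpq using Relation.ReflTransGen.head_induction_on with
  | refl => exact hq
  | head hedge _ ih =>
    obtain ⟨a, ha⟩ := hedge
    refine lt_of_lt_of_le ?_ (hop _)
    refine mul_pos (by positivity) (Finset.sum_pos' (fun _ _ => Finset.sum_nonneg fun p _ => hx p)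
      ⟨a, Finset.mem_univ _, Finset.sum_pos' (fun p _ => hx p) ⟨_, ha, ih⟩⟩)

/-- Strong connectivity allows a single state without edges; the non-zero solution excludes it. -/
theorem exists_edge_of_isSolution (hsc : U.StronglyConnected) {ζ : Q → ℝ} (hζ : U.IsSolution ζ)
    (hne : ζ ≠ 0) (p : Q) : ∃ r, U.Edge p r := by
  obtain ⟨q, hq⟩ := Function.ne_iff.1 hne
  rcases (hsc p q).cases_head with rfl | ⟨r, hr, _⟩
  · by_contra! hno
    refine hq ((hζ p).trans ?_)
    have : ∀ a, U.δ p a = ∅ := fun a => Finset.eq_empty_of_forall_notMem fun r hr => hno r ⟨a, hr⟩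
    simp [this]
  · exact ⟨r, hr⟩

end Operator

end NBA

/-! ### Finite runs: reachable sets and weights. -/

namespace NBA

variable {Q A : Type*} (U : NBA Q A)

open Classical in
/-- The states reachable from `q` by reading the first `n` letters of `w`. -/
noncomputable def reach : ℕ → Q → (ℕ → A) → Finset Q
  | 0, q, _ => {q}
  | n + 1, q, w => (U.δ q (w 0)).biUnion fun p => reach n p (tailWord w)

/-- The sum of `g` over the end states of all runs from `q` on the first `n` letters of `w`. -/
noncomputable def weight (g : Q → ENNReal) : ℕ → Q → (ℕ → A) → ENNReal
  | 0, q, _ => g q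
  | n + 1, q, w => ∑ p ∈ U.δ q (w 0), weight g n p (tailWord w)

variable {U}

/-- The word `u` is the first `n` letters of `w` followed by `v`; it does not depend on `q`. -/
theorem exists_mem_omegaLanguage_of_mem_reach {n : ℕ} {w v : ℕ → A} {p : Q}
    (hv : v ∈ (U.startingAt p).omegaLanguage) :
    ∃ u, ∀ q, p ∈ U.reach n q w → u ∈ (U.startingAt q).omegaLanguage := by
  induction n generalizing w with
  | zero =>
    refine ⟨v, fun q hq => ?_⟩
    rw [reach, Finset.mem_singleton] at hq
    exact hq ▸ hv
  | succ n ih =>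
    obtain ⟨u, hu⟩ := ih (w := tailWord w)
    refine ⟨consWord (w 0) u, fun q hq => ?_⟩
    simp only [reach, Finset.mem_biUnion] at hq
    obtain ⟨r, hr, hp⟩ := hq
    exact consWord_mem_omegaLanguage_iff.2 ⟨r, hr, hu r hp⟩

/-- Two runs on `w` from `q` merging in `p` would both extend along a word accepted from `p`,
against unambiguity. So each reached state is counted once. -/
theorem weight_eq_sum_reach (hU : ∀ q, (U.startingAt q).Unambiguous)
    (hne : ∀ q, (U.startingAt q).omegaLanguage.Nonempty) (g : Q → ENNReal) (n : ℕ) (q : Q)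
    (w : ℕ → A) : U.weight g n q w = ∑ p ∈ U.reach n q w, g p := by
  classical
  induction n generalizing q w with
  | zero => simp [weight, reach]
  | succ n ih =>
    have hdisj : ((U.δ q (w 0) : Finset Q) : Set Q).PairwiseDisjoint
        fun p => U.reach n p (tailWord w) := by
      intro r hr r' hr' hrr'
      refine Finset.disjoint_left.2 fun p hp hp' => ?_
      obtain ⟨v, hv⟩ := hne p
      obtain ⟨u, hu⟩ := exists_mem_omegaLanguage_of_mem_reach (n := n) (w := tailWord w) hv
      exact Set.disjoint_left.1 (disjoint_omegaLanguage hU hr hr' hrr') (hu r hp) (hu r' hp')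
    rw [weight, reach]
    convert (Finset.sum_congr rfl fun p _ => ih p (tailWord w)).trans
      (Finset.sum_biUnion hdisj).symm

theorem reach_nonempty_of_succ {n : ℕ} {q : Q} {w : ℕ → A} (h : (U.reach (n + 1) q w).Nonempty) :
    (U.reach n q w).Nonempty := by
  classical
  induction n generalizing q w with
  | zero => exact Finset.singleton_nonempty q
  | succ n ih =>
    rw [reach, Finset.biUnion_nonempty] at h ⊢
    obtain ⟨p, hp, h⟩ := h
    exact ⟨p, hp, ih h⟩

theorem antitone_reach_nonempty (q : Q) :
    Antitone fun n => {w : ℕ → A | (U.reach n q w).Nonempty} :=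
  antitone_nat_of_succ_le fun _ _ h => reach_nonempty_of_succ h

/-- König's lemma for runs. -/
theorem exists_run_of_forall_reach_nonempty {q : Q} {w : ℕ → A}
    (h : ∀ n, (U.reach n q w).Nonempty) :
    ∃ ρ : ℕ → Q, ρ 0 = q ∧ ∀ i, ρ (i + 1) ∈ U.δ (ρ i) (w i) := by
  have hstep : ∀ (q : Q) (w : ℕ → A), (∀ n, (U.reach n q w).Nonempty) →
      ∃ p ∈ U.δ q (w 0), ∀ n, (U.reach n p (tailWord w)).Nonempty := by
    classical
    intro q w h
    by_contra! hno
    -- `N p` is a level at which all runs from `p` have died; its maximum over the finitely many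
    -- successors kills every run from `q`.
    choose! N hN using hno
    have hn := h ((U.δ q (w 0)).sup N + 1)
    rw [reach, Finset.biUnion_nonempty] at hn
    obtain ⟨p, hp, hne⟩ := hn
    have := antitone_reach_nonempty p (Finset.le_sup (f := N) hp) hne
    exact Finset.not_nonempty_iff_eq_empty.2 (hN p hp) this
  choose! next hnext hreach using hstep
  let ρ : ℕ → Q := fun n => Nat.rec q (fun i p => next p (tailWord^[i] w)) n
  have hρ : ∀ i, ∀ n, (U.reach n (ρ i) (tailWord^[i] w)).Nonempty := by
    intro i
    induction i with
    | zero => exact h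
    | succ i ih =>
      rw [Function.iterate_succ_apply']
      exact hreach _ _ ih
  have htail : ∀ i, tailWord^[i] w 0 = w i := by
    intro i
    have : ∀ j, tailWord^[i] w j = w (j + i) := by
      induction i with
      | zero => simp
      | succ i ih =>
        intro j
        rw [Function.iterate_succ_apply', tailWord, ih]
        congr 1
        omega
    simpa using this 0
  refine ⟨ρ, rfl, fun i => ?_⟩
  rw [← htail i]
  exact hnext _ _ (hρ i)

theorem le_weight_of_run {g : Q → ENNReal} {c : ENNReal} (hc : ∀ q, c ≤ g q) {w : ℕ → A}
    {ρ : ℕ → Q} (hρ : ∀ i, ρ (i + 1) ∈ U.δ (ρ i) (w i)) (n : ℕ) : c ≤ U.weight g n (ρ 0) w := by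
  induction n generalizing w ρ with
  | zero => exact hc _
  | succ n ih =>
    rw [weight]
    exact (ih (w := tailWord w) (ρ := tailWord ρ) fun i => hρ (i + 1)).trans
      (Finset.single_le_sum (f := fun p => U.weight g n p (tailWord w))
        (fun _ _ => zero_le) (hρ 0))

section AvoidFinal

variable [Fintype A]

variable (U) in
open Classical in
/-- The automaton `U` with all transitions leaving final states removed. -/
noncomputable def avoidFinal : NBA Q A :=
  { U with δ := fun q a => if q ∈ U.final then ∅ else U.δ q a }

theorem avoidFinal_op_of_mem {q : Q} (hq : q ∈ U.final) (x : Q → ℝ) : U.avoidFinal.op x q = 0 := by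
  simp [op, avoidFinal, hq]

theorem avoidFinal_op_le {x : Q → ℝ} (hx : 0 ≤ x) : U.avoidFinal.op x ≤ U.op x := by
  intro q
  by_cases hq : q ∈ U.final
  · rw [avoidFinal_op_of_mem hq]
    exact op_nonneg hx q
  · simp [op, avoidFinal, hq]

/-- The iterates decrease to a fixed point `g` that vanishes at final states; a maximum principle
for the ratio `g / h` forces `g = 0`. -/
theorem tendsto_iterate_avoidFinal_op [Finite Q] [Nonempty A] (hsc : U.StronglyConnected)
    (hfinal : U.final.Nonempty) {h : Q → ℝ} (hh : U.op h = h) (hpos : ∀ q, 0 < h q) (q : Q) :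
    Tendsto (fun n => U.avoidFinal.op^[n] h q) atTop (nhds 0) := by
  have hnn : 0 ≤ h := fun q => (hpos q).le
  have hanti : Antitone fun n => U.avoidFinal.op^[n] h :=
    op_mono.antitone_iterate_of_map_le ((avoidFinal_op_le hnn).trans hh.le)
  have hlim : ∀ q, ∃ l, Tendsto (fun n => U.avoidFinal.op^[n] h q) atTop (nhds l) := fun q =>
    ⟨_, tendsto_atTop_ciInf (fun _ _ hmn => hanti hmn q)
      ⟨0, by rintro _ ⟨n, rfl⟩; exact iterate_op_nonneg hnn n q⟩⟩
  choose g hg using hlim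
  have hfix : U.avoidFinal.op g = g := op_eq_of_tendsto_iterate (tendsto_pi_nhds.2 hg)
  have hg0 : 0 ≤ g := fun q => ge_of_tendsto' (hg q) fun n => iterate_op_nonneg hnn n q
  have : Nonempty Q := ⟨q⟩
  obtain ⟨m, hm⟩ := Finite.exists_max fun q => g q / h q
  set c := g m / h m with hc
  have hc0 : 0 ≤ c := div_nonneg (hg0 m) (hnn m)
  have hle : g ≤ c • h := fun p => (div_le_iff₀ (hpos p)).1 (hm p)
  rcases hc0.eq_or_lt with hc0 | hc0
  · have : g q = 0 := le_antisymm (by simpa [← hc0] using hle q) (hg0 q)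
    exact this ▸ hg q
  · obtain ⟨f, hf⟩ := hfinal
    have hgf : g f = 0 := by rw [← hfix, avoidFinal_op_of_mem hf]
    -- This nonnegative supersolution is positive at `f`, hence everywhere, yet it vanishes at the
    -- maximizer `m`.
    have hsup : U.op (c • h - g) ≤ c • h - g := by
      rw [op_sub, op_smul, hh]
      exact sub_le_sub_left (hfix.ge.trans (avoidFinal_op_le hg0)) _
    have hposm := pos_of_reflTransGen (sub_nonneg.2 hle) hsup (hsc m f)
      (by simpa [hgf] using mul_pos hc0 (hpos f))
    have : c * h m = g m := div_mul_cancel₀ _ (hpos m).ne'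
    simp [this] at hposm

end AvoidFinal

/-! ### Probabilistic estimates and the three implications. -/

section Measure

variable [Fintype A] [MeasurableSpace A] [DiscreteMeasurableSpace A]

theorem measurable_weight (g : Q → ENNReal) (n : ℕ) (q : Q) : Measurable (U.weight g n q) := by
  induction n generalizing q with
  | zero => exact measurable_const
  | succ n ih =>
    refine measurable_of_comp_consWord fun a => ?_
    simp only [weight, consWord_zero, tailWord_consWord]
    exact Finset.measurable_sum _ fun p _ => ih p

theorem measurableSet_reach_nonempty (n : ℕ) (q : Q) :
    MeasurableSet {w : ℕ → A | (U.reach n q w).Nonempty} := by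
  induction n generalizing q with
  | zero => simp [reach]
  | succ n ih =>
    refine measurableSet_of_preimage_consWord fun a => ?_
    have : consWord a ⁻¹' {w : ℕ → A | (U.reach (n + 1) q w).Nonempty} =
        ⋃ p ∈ U.δ q a, {w : ℕ → A | (U.reach n p w).Nonempty} := by
      ext w
      simp [reach, Finset.biUnion_nonempty]
    rw [this]
    exact .biUnion (Finset.countable_toSet _) fun p _ => ih p

variable [Nonempty A]

theorem lintegral_weight {g : Q → ℝ} (hg : 0 ≤ g) (n : ℕ) (q : Q) :
    ∫⁻ w, U.weight (fun p => ENNReal.ofReal (g p)) n q w ∂uniformWordMeasure A =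
      ENNReal.ofReal (U.op^[n] g q) := by
  induction n generalizing q with
  | zero => simp [weight]
  | succ n ih =>
    have hnn : ∀ p, 0 ≤ U.op^[n] g p := iterate_op_nonneg hg n
    rw [lintegral_uniformWordMeasure, Function.iterate_succ_apply', op,
      ENNReal.ofReal_mul (by positivity),
      ENNReal.ofReal_sum_of_nonneg fun a _ => Finset.sum_nonneg fun p _ => hnn p,
      one_div, ENNReal.ofReal_inv_of_pos (by positivity), ENNReal.ofReal_natCast]
    congr 1
    refine Finset.sum_congr rfl fun a _ => ?_
    simp only [weight, consWord_zero, tailWord_consWord]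
    rw [lintegral_finsetSum _ fun p _ => measurable_weight _ n p,
      ENNReal.ofReal_sum_of_nonneg fun p _ => hnn p]
    exact Finset.sum_congr rfl fun p _ => ih p

/-- The iterate is the expected weight, which is at most `∑ p, g p` and vanishes where no run
survives. -/
theorem ofReal_iterate_op_le [Fintype Q] (hU : ∀ q, (U.startingAt q).Unambiguous)
    (hne : ∀ q, (U.startingAt q).omegaLanguage.Nonempty) {g : Q → ℝ} (hg : 0 ≤ g) (n : ℕ) (q : Q) :
    ENNReal.ofReal (U.op^[n] g q) ≤
      ENNReal.ofReal (∑ p, g p) * uniformWordMeasure A {w | (U.reach n q w).Nonempty} := by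
  classical
  rw [← lintegral_weight hg, ← lintegral_indicator_const (measurableSet_reach_nonempty n q)]
  refine lintegral_mono fun w => ?_
  rw [weight_eq_sum_reach hU hne]
  by_cases hw : (U.reach n q w).Nonempty
  · rw [Set.indicator_of_mem (by exact hw), ENNReal.ofReal_sum_of_nonneg fun p _ => hg p]
    exact Finset.sum_le_sum_of_subset (Finset.subset_univ _)
  · simp [Finset.not_nonempty_iff_eq_empty.1 hw]

theorem iterate_op_le_sum [Fintype Q] (hU : ∀ q, (U.startingAt q).Unambiguous)
    (hne : ∀ q, (U.startingAt q).omegaLanguage.Nonempty) {g : Q → ℝ} (hg : 0 ≤ g) (n : ℕ) (q : Q) :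
    U.op^[n] g q ≤ ∑ p, g p := by
  rw [← ENNReal.ofReal_le_ofReal_iff (Finset.sum_nonneg fun p _ => hg p)]
  exact (ofReal_iterate_op_le hU hne hg n q).trans (mul_le_of_le_one_right' prob_le_one)

theorem exists_pos_isSolution [Finite Q] (hU : ∀ q, (U.startingAt q).Unambiguous)
    (hsc : U.StronglyConnected) (hne : ∀ q, (U.startingAt q).omegaLanguage.Nonempty)
    {ζ : Q → ℝ} (hζ : U.IsSolution ζ) (hζ0 : ζ ≠ 0) :
    ∃ h : Q → ℝ, U.IsSolution h ∧ ∀ q, 0 < h q := by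
  cases nonempty_fintype Q
  have hle : |ζ| ≤ U.op |ζ| := by
    conv_lhs => rw [← isSolution_iff_op_eq.1 hζ]
    exact abs_op_le ζ
  have hmono : Monotone fun n => U.op^[n] |ζ| := op_mono.monotone_iterate_of_le_map hle
  have hlim : ∀ q, ∃ l, Tendsto (fun n => U.op^[n] |ζ| q) atTop (nhds l) := fun q =>
    ⟨_, tendsto_atTop_ciSup (fun _ _ hmn => hmono hmn q)
      ⟨∑ p, |ζ| p, by rintro _ ⟨n, rfl⟩; exact iterate_op_le_sum hU hne (abs_nonneg ζ) n q⟩⟩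
  choose h hh using hlim
  have hfix : U.op h = h := op_eq_of_tendsto_iterate (tendsto_pi_nhds.2 hh)
  have hge : |ζ| ≤ h := fun q => ge_of_tendsto (hh q)
    (Eventually.of_forall fun n => hmono n.zero_le q)
  obtain ⟨q, hq⟩ := Function.ne_iff.1 hζ0
  exact ⟨h, isSolution_iff_op_eq.2 hfix, fun p => pos_of_reflTransGen ((abs_nonneg ζ).trans hge)
    hfix.le (hsc p q) ((abs_pos.2 hq).trans_le (hge q))⟩

theorem measure_run_avoiding_final [Finite Q] (hsc : U.StronglyConnected)
    (hfinal : U.final.Nonempty) {h : Q → ℝ} (hh : U.op h = h) (hpos : ∀ q, 0 < h q) (q : Q) :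
    uniformWordMeasure A {w | ∃ ρ : ℕ → Q, ρ 0 = q ∧
      (∀ i, ρ (i + 1) ∈ U.δ (ρ i) (w i)) ∧ ∀ i, ρ i ∉ U.final} = 0 := by
  set D := {w : ℕ → A | ∃ ρ : ℕ → Q, ρ 0 = q ∧
      (∀ i, ρ (i + 1) ∈ U.δ (ρ i) (w i)) ∧ ∀ i, ρ i ∉ U.final}
  have hnn : 0 ≤ h := fun q => (hpos q).le
  have : Nonempty Q := ⟨q⟩
  obtain ⟨m, hm⟩ := Finite.exists_min h
  have hle : ∀ n, ENNReal.ofReal (h m) * uniformWordMeasure A D ≤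
      ENNReal.ofReal (U.avoidFinal.op^[n] h q) := by
    intro n
    rw [← lintegral_weight hnn]
    -- Markov's inequality: on `D` the surviving run alone contributes at least `min h` to the
    -- weight.
    refine le_trans ?_ (mul_meas_ge_le_lintegral (measurable_weight _ n q)
      (ENNReal.ofReal (h m)))
    gcongr
    rintro w ⟨ρ, rfl, hρ, hF⟩
    refine le_weight_of_run (fun p => ENNReal.ofReal_le_ofReal (hm p)) (fun i => ?_) n
    simpa [avoidFinal, hF i] using hρ i
  have hlim := (ENNReal.tendsto_ofReal (tendsto_iterate_avoidFinal_op hsc hfinal hh hpos q))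
  have := ge_of_tendsto' hlim hle
  rw [ENNReal.ofReal_zero, nonpos_iff_eq_zero, mul_eq_zero] at this
  exact this.resolve_left (by simpa using hpos m)

theorem measure_omegaLanguage_startingAt_pos [Finite Q] (hU : ∀ q, (U.startingAt q).Unambiguous)
    (hsc : U.StronglyConnected) (hfinal : U.final.Nonempty)
    (hne : ∀ q, (U.startingAt q).omegaLanguage.Nonempty)
    {h : Q → ℝ} (hh : U.op h = h) (hpos : ∀ q, 0 < h q) (q : Q) :
    0 < uniformWordMeasure A (U.startingAt q).omegaLanguage := by
  cases nonempty_fintype Q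
  have hnn : 0 ≤ h := fun q => (hpos q).le
  set E : Set (ℕ → A) := ⋂ n, {w | (U.reach n q w).Nonempty}
  have hE : 0 < uniformWordMeasure A E := by
    have hlim : Tendsto (fun n => uniformWordMeasure A {w | (U.reach n q w).Nonempty}) atTop
        (nhds (uniformWordMeasure A E)) :=
      tendsto_measure_iInter_atTop
        (fun n => (measurableSet_reach_nonempty n q).nullMeasurableSet)
        (antitone_reach_nonempty q) ⟨0, measure_ne_top _ _⟩
    have hlim' := ENNReal.Tendsto.const_mul (a := ENNReal.ofReal (∑ p, h p)) hlim
      (.inr ENNReal.ofReal_ne_top)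
    have hbound : ENNReal.ofReal (h q) ≤
        ENNReal.ofReal (∑ p, h p) * uniformWordMeasure A E := by
      refine ge_of_tendsto' hlim' fun n => ?_
      have := ofReal_iterate_op_le hU hne hnn n q
      rwa [Function.iterate_fixed hh] at this
    exact pos_of_mul_pos_right ((ENNReal.ofReal_pos.2 (hpos q)).trans_le hbound) zero_le
  set D : Q → Set (ℕ → A) := fun p => {w | ∃ ρ : ℕ → Q, ρ 0 = p ∧
      (∀ i, ρ (i + 1) ∈ U.δ (ρ i) (w i)) ∧ ∀ i, ρ i ∉ U.final}
  -- The measure is shift-invariant, so avoiding final states from time `n` on is also a null event.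
  have hD : ∀ (n : ℕ) (p : Q), uniformWordMeasure A {w | (fun i => w (i + n)) ∈ D p} = 0 := by
    intro n p
    induction n with
    | zero => exact measure_run_avoiding_final hsc hfinal hh hpos p
    | succ n ih =>
      rw [← uniformWordMeasure_preimage_tailWord] at ih
      exact ih
  have hsub : E ⊆ (U.startingAt q).omegaLanguage ∪
      ⋃ (n : ℕ) (p : Q), {w | (fun i => w (i + n)) ∈ D p} := by
    intro w hw
    obtain ⟨ρ, h0, hρ⟩ := exists_run_of_forall_reach_nonempty (Set.mem_iInter.1 hw)
    by_cases hf : ∃ᶠ i in atTop, ρ i ∈ U.final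
    · exact .inl ⟨ρ, isAcceptingRun_startingAt_iff.2 ⟨h0, hρ, hf⟩⟩
    · rw [not_frequently, eventually_atTop] at hf
      obtain ⟨n, hn⟩ := hf
      refine .inr (Set.mem_iUnion₂.2 ⟨n, ρ n, fun i => ρ (i + n), by simp, fun i => ?_,
        fun i => hn _ (Nat.le_add_left _ _)⟩)
      have := hρ (i + n)
      rwa [Nat.add_right_comm] at this
  refine hE.trans_le ((measure_mono hsub).trans ((measure_union_le _ _).trans ?_))
  rw [measure_iUnion_null fun n => measure_iUnion_null fun p => hD n p, add_zero]

theorem isSolution_measureReal_omegaLanguage [Finite Q]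
    (hU : ∀ q, (U.startingAt q).Unambiguous) :
    U.IsSolution fun q => (uniformWordMeasure A).real (U.startingAt q).omegaLanguage := by
  intro q
  have hpre : ∀ a, uniformWordMeasure A (consWord a ⁻¹' (U.startingAt q).omegaLanguage) =
      ∑ p ∈ U.δ q a, uniformWordMeasure A (U.startingAt p).omegaLanguage := by
    intro a
    have : consWord a ⁻¹' (U.startingAt q).omegaLanguage =
        ⋃ p ∈ U.δ q a, (U.startingAt p).omegaLanguage := by
      ext w
      simp [consWord_mem_omegaLanguage_iff]
    rw [this, measure_biUnion_finset]
    · exact fun p hp p' hp' hne => disjoint_omegaLanguage hU hp hp' hne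
    · exact fun p _ => measurableSet_omegaLanguage (hU p)
  simp only [measureReal_def]
  rw [uniformWordMeasure_apply, Finset.sum_congr rfl fun a _ => hpre a, ENNReal.toReal_mul,
    ENNReal.toReal_inv, ENNReal.toReal_natCast, one_div,
    ENNReal.toReal_sum fun a _ => ENNReal.sum_ne_top.2 fun p _ => measure_ne_top _ _]
  simp_rw [ENNReal.toReal_sum fun p _ => measure_ne_top (uniformWordMeasure A) _]

end Measure

end NBA

theorem mainTheorem2 {Q A : Type*} [Finite Q] [Fintype A] [Nonempty A]
    [MeasurableSpace A] [DiscreteMeasurableSpace A]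
    (U : NBA Q A) (hU : U.Unambiguous) (hsc : U.StronglyConnected)
    (hinit : U.init.Nonempty) (hfinal : U.final.Nonempty) :
    List.TFAE [
      0 < uniformWordMeasure A U.omegaLanguage,
      ∃ ζ : Q → ℝ, U.IsSolution ζ ∧ ∀ q, 0 < ζ q,
      ∃ ζ : Q → ℝ, U.IsSolution ζ ∧ ζ ≠ 0] := by
  have hU' := NBA.unambiguous_startingAt hU hsc hinit
  have hne : ∀ ζ : Q → ℝ, U.IsSolution ζ → ζ ≠ 0 →
      ∀ q, (U.startingAt q).omegaLanguage.Nonempty := fun ζ hζ hζ0 =>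
    NBA.nonempty_omegaLanguage_startingAt hsc hfinal (NBA.exists_edge_of_isSolution hsc hζ hζ0)
  obtain ⟨q₀, hq₀⟩ := hinit
  have hne0 : ∀ ζ : Q → ℝ, (∀ q, 0 < ζ q) → ζ ≠ 0 := fun ζ hpos h0 =>
    (hpos q₀).ne' (congrFun h0 q₀)
  tfae_have 1 → 2 := by
    intro h
    have hsub : U.omegaLanguage ⊆ ⋃ q, (U.startingAt q).omegaLanguage := by
      rintro w ⟨ρ, hρ⟩
      exact Set.mem_iUnion.2
        ⟨ρ 0, ρ, NBA.isAcceptingRun_startingAt_iff.2 ⟨rfl, hρ.1.2, hρ.2⟩⟩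
    obtain ⟨q, hq⟩ : ∃ q, uniformWordMeasure A (U.startingAt q).omegaLanguage ≠ 0 := by
      by_contra! h0
      exact h.ne' (measure_mono_null hsub (measure_iUnion_null h0))
    have hsol := NBA.isSolution_measureReal_omegaLanguage hU'
    exact ⟨_, hsol, fun p => NBA.pos_of_reflTransGen (fun _ => measureReal_nonneg)
      (NBA.isSolution_iff_op_eq.1 hsol).le (hsc p q)
      (ENNReal.toReal_pos hq (measure_ne_top _ _))⟩
  tfae_have 2 → 3 := by
    rintro ⟨ζ, hζ, hpos⟩
    exact ⟨ζ, hζ, hne0 ζ hpos⟩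
  tfae_have 3 → 2 := by
    rintro ⟨ζ, hζ, hζ0⟩
    exact NBA.exists_pos_isSolution hU' hsc (hne ζ hζ hζ0) hζ hζ0
  tfae_have 2 → 1 := by
    rintro ⟨ζ, hζ, hpos⟩
    refine (NBA.measure_omegaLanguage_startingAt_pos hU' hsc hfinal (hne ζ hζ (hne0 ζ hpos))
      (NBA.isSolution_iff_op_eq.1 hζ) hpos q₀).trans_le (measure_mono ?_)
    rintro w ⟨ρ, hρ⟩
    obtain ⟨rfl, h⟩ := NBA.isAcceptingRun_startingAt_iff.1 hρ
    exact ⟨ρ, ⟨hq₀, h.1⟩, h.2⟩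
  tfae_finish
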